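/- **Conventions.** An alphabet is a finite set. $A^{\mathbb{Z}^d}$ carries the product of the discrete topologies and the shift action $(\sigma_t x)(s)=x(s+t)$; $O(x)$ is the orbit of $x$. A $\mathbb{Z}^d$-subshift over $A$ is a nonempty, closed, shift-invariant subset of $A^{\mathbb{Z}^d}$. A pattern of shape $S$ ($S\subset\mathbb{Z}^d$ finite) is an element of $A^S$; it appears in $x$ if it equals, up to translation, the restriction of $x$ to a translate of $S$. A subshift is an SFT if it is the set of all points in which no pattern from some finite list of patterns appears. $L(X)$ is the set of patterns appearing in points of $X$, and $L_S(X)$ is the set of those of shape $S$. A pattern $w$ of shape $S$ has positive measure for $\mu$ if $\mu(\{x : x|_S=w\})>0$, and $\mathcal{M}(X)$ is the set of shift-invariant Borel probability measures on $X$. A $\mathbb{Z}^d$ topological dynamical system is a compact metric space $Y$ with a $\mathbb{Z}^d$-action $(S_v)$ by homeomorphisms, and its topological entropy is $$h(Y,S_v)=\sup_{\mathcal{U}}\ \lim_{n\to\infty}\frac{1}{n^d}\log N\Big(\bigvee_{v\in[1,n]^d}S_v\,\mathcal{U}\Big),$$ where $\mathcal{U}$ ranges over open covers of $Y$ and $N(\cdot)$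 is the minimal cardinality of a subcover. The system $X$ has topologically completely positive entropy (TCPE) if for every continuous, surjective, action-commuting map from $X$ onto a $\mathbb{Z}^d$ topological dynamical system $(Y,S_v)$, either $h(Y,S_v)>0$ or $|Y|=1$. **Theorem.** Let $d\le 2$ be a natural number (for $d=0$, $\mathbb{Z}^d$ is the trivial group), and let $A$ be an alphabet. There exist an alphabet $B$ and a map $f$ taking the orbit of each point of $A^{\mathbb{Z}^d}$ to a nonempty union of orbits of points of $B^{\mathbb{Z}^d}$, such that, writing $f(X)=\bigcup_{x\in X} f(O(x))$ for a subshift $X$ over $A$: 1. If $O(x)\ne O(x')$, then $f(O(x))\cap f(O(x'))=\varnothing$. 2. For every $\mathbb{Z}^d$-subshift (resp. SFT) $X$ over $A$, $f(X)$ is a $\mathbb{Z}^d$-subshift (resp. SFT) over $B$. 3. Let $X$ be a $\mathbb{Z}^d$-subshift over $A$ such that (a) every $w\in L(X)$ has positive measure for some $\mu\in\mathcal{M}(X)$; and (b) there exists $N\geq 1$ such that for every $n\ge 0$ and all $w,w'\in L_{[-n,n]^d}(X)$ there exist patterns $w=w_1,w_2,\dots,w_N=w'$ in $L_{[-n,n]^d}(X)$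 such that for all $1\le i<N$, $w_i$ and $w_{i+1}$ both appear in some common point of $X$. Then $f(X)$ has TCPE. -/

import Mathlib

open Filter MeasureTheory Set

universe u

noncomputable section

/-- The full shift `A^{ℤ^d}`. -/
def FullShift (d : ℕ) (A : Type u) : Type u := (Fin d → ℤ) → A

namespace FullShift

variable {d : ℕ} {A : Type u}

/-- The product of the discrete topologies. -/
instance : TopologicalSpace (FullShift d A) :=
  @Pi.topologicalSpace (Fin d → ℤ) (fun _ => A) (fun _ => ⊥)

/-- The Borel σ-algebra of that topology. -/
instance : MeasurableSpace (FullShift d A) := borel _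

instance : BorelSpace (FullShift d A) := ⟨rfl⟩

/-- The shift action, `(σ_t x)(s) = x (s + t)`. -/
instance : AddAction (Fin d → ℤ) (FullShift d A) where
  vadd t x := fun s => x (s + t)
  zero_vadd x := funext fun s => congrArg x (add_zero s)
  add_vadd t t' x := funext fun s => congrArg x (add_assoc s t t').symm

end FullShift

/-- A pattern of shape `S` over `A`. -/
abbrev Pattern {d : ℕ} (A : Type u) (S : Finset (Fin d → ℤ)) : Type u := S → A

/-- `w` appears in `x`, at some translate of its shape. -/
def Pattern.AppearsIn {d : ℕ} {A : Type u} {S : Finset (Fin d → ℤ)}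
    (w : Pattern A S) (x : FullShift d A) : Prop :=
  ∃ v : Fin d → ℤ, ∀ s : S, x ((s : Fin d → ℤ) + v) = w s

/-- The cylinder `[w] = {x : x(S) = w}`. -/
def Pattern.cylinder {d : ℕ} {A : Type u} {S : Finset (Fin d → ℤ)}
    (w : Pattern A S) : Set (FullShift d A) :=
  {x | ∀ s : S, x (s : Fin d → ℤ) = w s}

/-- A `ℤ^d`-subshift over `A`: a nonempty, closed, shift-invariant set of points. -/
structure Subshift (d : ℕ) (A : Type u) where
  carrier : Set (FullShift d A)
  nonempty' : carrier.Nonempty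
  isClosed' : IsClosed carrier
  vadd_mem' : ∀ (v : Fin d → ℤ) (x : FullShift d A), x ∈ carrier → v +ᵥ x ∈ carrier

namespace Subshift

variable {d : ℕ} {A : Type u}

/-- The shift action restricted to a subshift. -/
instance (X : Subshift d A) : AddAction (Fin d → ℤ) X.carrier where
  vadd v x := ⟨v +ᵥ (x : FullShift d A), X.vadd_mem' v x x.2⟩
  zero_vadd x := Subtype.ext (zero_vadd _ (x : FullShift d A))
  add_vadd v v' x := Subtype.ext (add_vadd v v' (x : FullShift d A))

/-- `X` is a shift of finite type: it is the set of points in which no pattern of some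
finite list `F` of patterns appears. -/
def IsSFT (X : Subshift d A) : Prop :=
  ∃ F : Set (Σ S : Finset (Fin d → ℤ), Pattern A S), F.Finite ∧
    X.carrier = {x | ∀ p ∈ F, ¬ p.2.AppearsIn x}

/-- `L_S(X)`: the patterns of shape `S` which appear in points of `X`. -/
def language (X : Subshift d A) (S : Finset (Fin d → ℤ)) : Set (Pattern A S) :=
  {w | ∃ x ∈ X.carrier, w.AppearsIn x}

/-- Shift-invariant Borel probability measures on `X`, as measures on the full shift that
give no mass to the complement of `X`. -/
def invariantMeasures (X : Subshift d A) : Set (Measure (FullShift d A)) :=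
  {μ | IsProbabilityMeasure μ ∧ μ X.carrierᶜ = 0 ∧
    ∀ v : Fin d → ℤ, MeasurePreserving (fun x : FullShift d A => v +ᵥ x) μ μ}

/-- Every pattern in the language has positive measure for some invariant measure. -/
def PatternsHavePositiveMeasure (X : Subshift d A) : Prop :=
  ∀ (S : Finset (Fin d → ℤ)), ∀ w ∈ X.language S,
    ∃ μ ∈ X.invariantMeasures, 0 < μ w.cylinder

/-- Two patterns coexist in some point of `X`. -/
def Coexist (X : Subshift d A) {S : Finset (Fin d → ℤ)} (w w' : Pattern A S) : Prop :=
  ∃ x ∈ X.carrier, w.AppearsIn x ∧ w'.AppearsIn x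

end Subshift

/-- The box `[-n,n]^d`. -/
def symmBox (d n : ℕ) : Finset (Fin d → ℤ) :=
  Finset.Icc (fun _ => -(n : ℤ)) (fun _ => (n : ℤ))

/-- The box `[1,n]^d`. -/
def posBox (d n : ℕ) : Finset (Fin d → ℤ) :=
  Finset.Icc (fun _ => (1 : ℤ)) (fun _ => (n : ℤ))

/-- There is a single `N` (not depending on `n` or the patterns) such that any two patterns
`w, w'` of `L_{[-n,n]^d}(X)` are joined by a chain `w = w_1, …, w_N = w'` in
`L_{[-n,n]^d}(X)` whose consecutive members coexist in points of `X`. -/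
def Subshift.UniformlyChainCoexistent {d : ℕ} {A : Type u} (X : Subshift d A) : Prop :=
  ∃ N : ℕ, 1 ≤ N ∧ ∀ n : ℕ, ∀ w ∈ X.language (symmBox d n), ∀ w' ∈ X.language (symmBox d n),
    ∃ c : ℕ → Pattern A (symmBox d n), c 1 = w ∧ c N = w' ∧
      (∀ i, 1 ≤ i → i ≤ N → c i ∈ X.language (symmBox d n)) ∧
      ∀ i, 1 ≤ i → i < N → X.Coexist (c i) (c (i + 1))

/-- `𝒰` is an open cover of `X`. -/
def IsOpenCoverFamily {X : Type u} [TopologicalSpace X] (𝒰 : Set (Set X)) : Prop :=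
  (∀ U ∈ 𝒰, IsOpen U) ∧ ⋃₀ 𝒰 = univ

/-- `N(𝒰)`: the minimal size of a subcollection of `𝒰` which covers `X`. -/
def minSubcoverCard {X : Type u} (𝒰 : Set (Set X)) : ℕ :=
  sInf {k | ∃ 𝒱 : Finset (Set X), (𝒱 : Set (Set X)) ⊆ 𝒰 ∧ ⋃₀ (𝒱 : Set (Set X)) = univ ∧
    𝒱.card = k}

/-- The join `⋁_{v ∈ S} T_v 𝒰`. -/
def joinCover {d : ℕ} {X : Type u} [AddAction (Fin d → ℤ) X]
    (S : Finset (Fin d → ℤ)) (𝒰 : Set (Set X)) : Set (Set X) :=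
  {W | ∃ U : (Fin d → ℤ) → Set X, (∀ v ∈ S, U v ∈ 𝒰) ∧
    W = ⋂ v ∈ S, (fun x : X => v +ᵥ x) '' U v}

/-- Topological entropy of a `ℤ^d`-action: the supremum over open covers `𝒰` of
`lim_n (1 / n^d) log N(⋁_{v ∈ [1,n]^d} T_v 𝒰)`. The limit exists by subadditivity,
so it is written as an upper limit. -/
def topEntropy (d : ℕ) (X : Type u) [TopologicalSpace X] [AddAction (Fin d → ℤ) X] : EReal :=
  ⨆ (𝒰 : Set (Set X)) (_ : IsOpenCoverFamily 𝒰),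
    limsup (fun n : ℕ =>
      ((Real.log (minSubcoverCard (joinCover (posBox d n) 𝒰)) / (n : ℝ) ^ d : ℝ) : EReal)) atTop

/-- Topologically completely positive entropy: for every surjective factor map onto a
`ℤ^d` topological dynamical system `Y` (a compact metric space with an action by
homeomorphisms), either `Y` has positive entropy or `Y` is a single point. -/
def HasTCPE (d : ℕ) (X : Type u) [TopologicalSpace X] [AddAction (Fin d → ℤ) X] : Prop :=
  ∀ (Y : Type u) [MetricSpace Y] [CompactSpace Y] [AddAction (Fin d → ℤ) Y]
    [ContinuousConstVAdd (Fin d → ℤ) Y] (φ : X → Y),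
    Continuous φ → Function.Surjective φ →
    (∀ (v : Fin d → ℤ) (x : X), φ (v +ᵥ x) = v +ᵥ φ x) →
    0 < topEntropy d Y ∨ Nat.card Y = 1

end

/-! A point `x` is coded by reading it along a map `v ↦ v + δ v`, where the displacement `δ` is
half-Lipschitz up to rounding (a wobble). Each symbol stores the radius-one block of `x` at `v + δ
v` and the gradient of `δ` mod 3. Such a map is coarsely bijective (`near_of_near`,
`exists_near_add`), so a code determines `x` up to a shift, and distinct orbits have disjoint
images. Being a wobble is a local condition, and local cocycles on `ℤ^d` integrate
(`exists_potential`), so a configuration with legal windows is globally a code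
(`exists_wobbleCode_eq`). Closedness and finite type follow.

Entropy comes from the freedom in `δ`. If large windows of `x` and `x'` lie in one pattern of `X`,
then near each occurrence of that pattern a wobble can drift so as to read either window, and return
to zero displacement outside a bounded region. Positive measure supplies occurrences with positive
density, and the choices there are independent (`exists_independent`). Hence a zero entropy factor
identifies the codes of `x` and `x'` (`factor_eq`). By compactness the bounded chains of windows
become chains of points (`exists_chain`), so such a factor is a single point. -/

/-! ### Sup-distance and boxes in `ℤ^d` -/

/-- The sup-distance between `v` and `w` is at most `r`. -/
def Near {d : ℕ} (r : ℕ) (v w : Fin d → ℤ) : Prop :=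
  ∀ i, v i - w i ≤ r ∧ w i - v i ≤ r

namespace Near

variable {d : ℕ} {r s : ℕ} {u v w : Fin d → ℤ}

theorem refl (r : ℕ) (v : Fin d → ℤ) : Near r v v := fun i => by omega

theorem symm (h : Near r v w) : Near r w v := fun i => (h i).symm

theorem mono (h : Near r v w) (hrs : r ≤ s) : Near s v w := fun i => by
  have := h i; omega

theorem trans (h : Near r u v) (h' : Near s v w) : Near (r + s) u w := fun i => by
  have := h i; have := h' i; omega

theorem add_right (h : Near r v w) (t : Fin d → ℤ) : Near r (v + t) (w + t) := fun i => by
  have := h i; simp only [Pi.add_apply]; omega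

end Near

theorem mem_symmBox {d n : ℕ} {v : Fin d → ℤ} : v ∈ symmBox d n ↔ Near n v 0 := by
  simp only [symmBox, Finset.mem_Icc, Pi.le_def, Near, Pi.zero_apply]
  constructor
  · rintro ⟨h, h'⟩ i
    have := h i; have := h' i; omega
  · intro h
    exact ⟨fun i => by have := h i; omega, fun i => by have := h i; omega⟩

theorem exists_near {d : ℕ} (v w : Fin d → ℤ) : ∃ k : ℕ, Near k v w := by
  refine ⟨∑ i, (v i - w i).natAbs, fun i => ?_⟩
  have := Finset.single_le_sum (f := fun i => (v i - w i).natAbs) (fun _ _ => Nat.zero_le _)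
    (Finset.mem_univ i)
  omega

theorem exists_near_finset {d : ℕ} {ι : Type*} (S : Finset ι) (g : ι → Fin d → ℤ) :
    ∃ k : ℕ, ∀ a ∈ S, Near k (g a) 0 := by
  classical
  induction S using Finset.induction_on with
  | empty => exact ⟨0, by simp⟩
  | insert a S _ ih =>
    obtain ⟨k, hk⟩ := ih
    obtain ⟨l, hl⟩ := exists_near (g a) 0
    refine ⟨k + l, fun b hb => ?_⟩
    rcases Finset.mem_insert.1 hb with rfl | hb
    · exact hl.mono (by omega)
    · exact (hk b hb).mono (by omega)

/-- The point of the box of radius `r` around `w` closest to `v`. -/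
def clampTo {d : ℕ} (r : ℕ) (w v : Fin d → ℤ) : Fin d → ℤ :=
  fun i => w i + max (-(r : ℤ)) (min r (v i - w i))

theorem clampTo_near {d : ℕ} (r : ℕ) (w v : Fin d → ℤ) : Near r (clampTo r w v) w := fun i => by
  simp only [clampTo]; omega

theorem near_clampTo {d r s : ℕ} {w v : Fin d → ℤ} (h : Near (s + r) v w) :
    Near s v (clampTo r w v) := fun i => by
  have := h i
  simp only [clampTo]; omega

/-! ### Coarse geometry of wobbles -/

/-- A displacement field of Lipschitz constant one half, up to rounding. -/
def IsWobble {d : ℕ} (δ : (Fin d → ℤ) → (Fin d → ℤ)) : Prop :=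
  ∀ v w, Near 2 v w → Near 1 (δ v) (δ w)

namespace IsWobble

variable {d : ℕ} {δ : (Fin d → ℤ) → (Fin d → ℤ)}

theorem zero : IsWobble (0 : (Fin d → ℤ) → (Fin d → ℤ)) := fun _ _ _ => Near.refl _ _

theorem add_const (h : IsWobble δ) (c : Fin d → ℤ) : IsWobble (fun v => δ v + c) :=
  fun v w hvw => (h v w hvw).add_right c

theorem comp_add (h : IsWobble δ) (t : Fin d → ℤ) : IsWobble (fun v => δ (v + t)) :=
  fun _ _ hvw => h _ _ (hvw.add_right t)

/-- Walk from `v` towards `w` in steps of size two: clamping `v` to the box of radius `2 * k` moves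
it by at most two. -/
theorem near (h : IsWobble δ) (k : ℕ) {v w : Fin d → ℤ} (hvw : Near (2 * k) v w) :
    Near k (δ v) (δ w) := by
  induction k generalizing v with
  | zero =>
    have : v = w := funext fun i => by have := hvw i; omega
    exact this ▸ Near.refl _ _
  | succ k ih =>
    have h1 := clampTo_near (2 * k) w v
    have h2 : Near 2 v (clampTo (2 * k) w v) :=
      near_clampTo (hvw.mono (by omega))
    exact ((h _ _ h2).trans (ih h1)).mono (by omega)

/-- `v ↦ v + δ v` is coarsely injective. -/
theorem near_of_near (h : IsWobble δ) {r : ℕ} {v w : Fin d → ℤ}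
    (hvw : Near r (v + δ v) (w + δ w)) : Near (2 * r + 2) v w := by
  -- An a priori bound improves itself: distance `2 * (r + 1 + k + 1)` changes `δ` by at most `r + k
  -- + 2`, so `v` and `w` are within `2 * r + k + 2`.
  have key : ∀ k, Near (2 * (r + 1 + k)) v w → Near (2 * r + 2) v w := by
    intro k
    induction k with
    | zero => exact fun h => h.mono (by omega)
    | succ k ih =>
      intro hk
      refine ih fun i => ?_
      have h1 := h.near _ hk i
      have h2 := hvw i
      simp only [Pi.add_apply] at h2
      omega
  obtain ⟨k, hk⟩ := exists_near v w
  exact key k (hk.mono (by omega))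

/-- `v ↦ v + δ v` has `1`-dense image. -/
theorem exists_near_add (h : IsWobble δ) (u : Fin d → ℤ) : ∃ v, Near 1 (v + δ v) u := by
  -- Fixed-point iteration `v ↦ u - δ v`: each step halves the residual, until rounding stops it at
  -- 1.
  have key : ∀ k, ∀ v, Near (2 * k) v (u - δ v) → ∃ v, Near 1 (v + δ v) u := by
    intro k
    induction k using Nat.strong_induction_on with
    | _ k ih =>
      intro v hv
      have h1 := h.near k hv
      by_cases hk : k ≤ 1
      · refine ⟨u - δ v, fun i => ?_⟩
        have := h1 i
        simp only [Pi.add_apply, Pi.sub_apply]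
        omega
      · refine ih ((k + 1) / 2) (by omega) (u - δ v) fun i => ?_
        have := h1 i
        simp only [Pi.sub_apply]
        omega
  obtain ⟨k, hk⟩ := exists_near u (u - δ u)
  exact key k u (hk.mono (by omega))

/-- Two fields with the same gradient on a box differ by a constant there. -/
theorem sub_eq_sub_of_grad {δ δ' : (Fin d → ℤ) → (Fin d → ℤ)} {v : Fin d → ℤ} {M : ℕ}
    (h : ∀ u, Near M u v → ∀ w, Near 1 w u → δ w - δ u = δ' w - δ' u) :
    ∀ w, Near M w v → δ w - δ v = δ' w - δ' v := by
  induction M with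
  | zero =>
    intro w hw
    exact h v (Near.refl _ _) w (hw.mono (by omega))
  | succ M ih =>
    intro w hw
    have h1 := clampTo_near M v w
    have h2 : Near 1 w (clampTo M v w) := near_clampTo (hw.mono (by omega))
    have e1 := ih (fun u hu => h u (hu.mono (by omega))) _ h1
    have e2 := h _ (h1.mono (by omega)) w h2
    rw [← sub_add_sub_cancel (δ w) (δ (clampTo M v w)), e1, e2, sub_add_sub_cancel]

end IsWobble

/-! ### Integrating local cocycles -/

/-- The neighbour of `v` obtained by moving every coordinate one step towards `0`. -/
def towardZero {d : ℕ} (v : Fin d → ℤ) : Fin d → ℤ := fun i => v i - (v i).sign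

theorem near_towardZero {d : ℕ} (v : Fin d → ℤ) : Near 1 v (towardZero v) := fun i => by
  simp only [towardZero]
  rcases lt_trichotomy (v i) 0 with h | h | h
  · rw [Int.sign_eq_neg_one_of_neg h]; omega
  · rw [h]; simp
  · rw [Int.sign_eq_one_of_pos h]; omega

theorem towardZero_near {d : ℕ} {v w : Fin d → ℤ} (hvw : Near 1 v w) :
    Near 1 (towardZero v) (towardZero w) := fun i => by
  have := hvw i
  simp only [towardZero]
  rcases lt_trichotomy (v i) 0 with h | h | h <;> rcases lt_trichotomy (w i) 0 with h' | h' | h' <;>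
    simp only [h, h', Int.sign_eq_neg_one_of_neg, Int.sign_eq_one_of_pos, Int.sign_zero] <;> omega

theorem towardZero_near_zero {d k : ℕ} {v : Fin d → ℤ} (hv : Near (k + 1) v 0) :
    Near k (towardZero v) 0 := fun i => by
  have := hv i
  simp only [towardZero, Pi.zero_apply] at *
  rcases lt_trichotomy (v i) 0 with h | h | h
  · rw [Int.sign_eq_neg_one_of_neg h]; omega
  · rw [h]; simp
  · rw [Int.sign_eq_one_of_pos h]; omega

/-- A locally defined additive cocycle on `ℤ^d` is the gradient of a function. -/
theorem exists_potential {d : ℕ} {E : Type*} [AddCommGroup E] (g : (Fin d → ℤ) → (Fin d → ℤ) → E)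
    (hg : ∀ u v w, Near 2 u v → Near 2 u w → Near 2 v w → g u v + g v w = g u w) :
    ∃ δ : (Fin d → ℤ) → E, ∀ v w, Near 1 v w → δ w - δ v = g v w := by
  have g0 : ∀ v, g v v = 0 := fun v => by
    simpa using hg v v v (Near.refl _ _) (Near.refl _ _) (Near.refl _ _)
  -- `D k v` sums `g` along `k` steps of the path from `v` towards `0`. Paths from neighbours stay
  -- neighbours, so their difference telescopes by the cocycle identity.
  let D : ℕ → (Fin d → ℤ) → E := fun k =>
    Nat.rec (fun _ => 0) (fun _ F v => F (towardZero v) + g (towardZero v) v) k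
  have D0 : ∀ v, D 0 v = 0 := fun _ => rfl
  have DS : ∀ k v, D (k + 1) v = D k (towardZero v) + g (towardZero v) v := fun _ _ => rfl
  have Dgrad : ∀ k v w, Near k v 0 → Near k w 0 → Near 1 v w → D k w - D k v = g v w := by
    intro k
    induction k with
    | zero =>
      intro v w hv hw _
      have : v = w := funext fun i => by have := hv i; have := hw i; omega
      rw [this, g0, sub_self]
    | succ k ih =>
      intro v w hv hw hvw
      have hp := towardZero_near hvw
      have e := ih _ _ (towardZero_near_zero hv) (towardZero_near_zero hw) hp
      have nw := near_towardZero w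
      have nv := near_towardZero v
      have e1 := hg (towardZero v) (towardZero w) w (hp.mono (by omega))
        ((nv.symm.trans hvw).mono (by omega)) (nw.symm.mono (by omega))
      have e2 := hg (towardZero v) v w (nv.symm.mono (by omega))
        ((nv.symm.trans hvw).mono (by omega)) (hvw.mono (by omega))
      rw [DS, DS, eq_sub_of_add_eq' e2, ← e1, ← e]
      abel
  -- Steps taken after reaching `0` contribute `g 0 0 = 0`, so `D k v` stabilises in `k`.
  have Dsucc : ∀ k v, Near k v 0 → D (k + 1) v = D k v := by
    intro k
    induction k with
    | zero =>
      intro v hv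
      have : v = 0 := funext fun i => by have := hv i; simp only [Pi.zero_apply] at *; omega
      have h0 : towardZero (0 : Fin d → ℤ) = 0 := funext fun i => by simp [towardZero]
      rw [this, DS 0, h0, g0, D0, add_zero]
    | succ k ih =>
      intro v hv
      rw [DS (k + 1), ih _ (towardZero_near_zero hv), ← DS k]
  have Dle : ∀ k l v, Near k v 0 → D (k + l) v = D k v := by
    intro k l v hv
    induction l with
    | zero => rfl
    | succ l ih => rw [← add_assoc, Dsucc _ _ (hv.mono (by omega)), ih]
  choose n hn using fun v : Fin d → ℤ => exists_near v 0
  refine ⟨fun v => D (n v) v, fun v w hvw => ?_⟩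
  have e1 := Dle (n v) (n w) v (hn v)
  have e2 := Dle (n w) (n v) w (hn w)
  rw [add_comm] at e2
  change D (n w) w - D (n v) v = g v w
  rw [← e1, ← e2]
  exact Dgrad _ _ _ ((hn v).mono (by omega)) ((hn w).mono (by omega)) hvw

/-! ### Cutting off and gluing wobbles -/

/-- A wobble can be flattened outside a large box without changing it on a given box. -/
theorem IsWobble.exists_flatten {d : ℕ} {δ : (Fin d → ℤ) → (Fin d → ℤ)} (h : IsWobble δ) (m : ℕ) :
    ∃ ρ : ℕ, ∃ η, IsWobble η ∧ (∀ v, Near m v 0 → η v = δ v) ∧ ∀ v, ¬ Near ρ v 0 → η v = 0 := by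
  obtain ⟨b, hb⟩ := exists_near_finset (symmBox d m) δ
  let N : (Fin d → ℤ) → ℕ := fun v => Finset.univ.sup fun i => (v i).natAbs
  have hN : ∀ v r, N v ≤ r ↔ Near r v 0 := fun v r => by
    simp only [N, Finset.sup_le_iff, Finset.mem_univ, true_imp_iff, Near, Pi.zero_apply]
    exact forall_congr' fun i => by omega
  -- `δ` is truncated to `[-κ, κ]`. The cap loses one per two steps outwards, so truncation keeps a
  -- wobble; it is at least `b` on the box of radius `m` and vanishes outside radius `2 * (b + m)`.
  let κ : (Fin d → ℤ) → ℕ := fun v => (b + m) - N v / 2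
  refine ⟨2 * (b + m), fun v i => max (-(κ v : ℤ)) (min (κ v) (δ v i)), ?_, ?_, ?_⟩
  · intro v w hvw i
    have h1 : N v ≤ N w + 2 := (hN _ _).2
      ((hvw.trans ((hN w _).1 le_rfl)).mono (by omega))
    have h2 : N w ≤ N v + 2 := (hN _ _).2
      ((hvw.symm.trans ((hN v _).1 le_rfl)).mono (by omega))
    have h3 := h v w hvw i
    simp only [κ]
    omega
  · intro v hv
    funext i
    have h1 := hb v (mem_symmBox.2 hv) i
    have h2 := (hN _ _).2 hv
    simp only [κ, Pi.zero_apply] at *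
    omega
  · intro v hv
    funext i
    have h2 : ¬ N v ≤ 2 * (b + m) := fun h' => hv ((hN _ _).1 h')
    simp only [κ, Pi.zero_apply] at *
    omega

/-- Wobbles of bounded support may be placed independently along a sparse lattice. -/
theorem IsWobble.exists_glue {d ρ L : ℕ} (hL : 2 * ρ + 2 < L)
    (η : (Fin d → ℤ) → (Fin d → ℤ) → (Fin d → ℤ)) (hη : ∀ j, IsWobble (η j))
    (h0 : ∀ j v, ¬ Near ρ v 0 → η j v = 0) :
    ∃ δ, IsWobble δ ∧ ∀ j v, Near ρ v 0 → δ (v - L • j) = η j v := by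
  classical
  let δ : (Fin d → ℤ) → (Fin d → ℤ) := fun v =>
    if h : ∃ j : Fin d → ℤ, Near ρ (v + L • j) 0 then η h.choose (v + L • h.choose) else 0
  -- The collar of width 2 matters because the wobble condition compares points at distance 2; `2 *
  -- ρ + 2 < L` keeps it off the other supports.
  have huniq : ∀ (v : Fin d → ℤ) (j j' : Fin d → ℤ), Near (ρ + 2) (v + L • j) 0 →
      Near ρ (v + L • j') 0 → j = j' := by
    intro v j j' hj hj'
    funext i
    have h1 := hj i
    have h2 := hj' i
    simp only [Pi.add_apply, Pi.smul_apply, Pi.zero_apply] at h1 h2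
    rw [nsmul_eq_mul] at h1 h2
    have hL' : ((2 * ρ + 2 : ℕ) : ℤ) < L := by exact_mod_cast hL
    push_cast at *
    rcases lt_trichotomy (j i) (j' i) with h | h | h
    · nlinarith
    · exact h
    · nlinarith
  have key : ∀ j v, Near (ρ + 2) (v + L • j) 0 → δ v = η j (v + L • j) := by
    intro j v hv
    by_cases h : ∃ j : Fin d → ℤ, Near ρ (v + L • j) 0
    · have e := huniq v j _ hv h.choose_spec
      simp only [δ, dif_pos h]
      rw [← e]
    · simp only [δ, dif_neg h]
      rw [h0 j _ fun h' => h ⟨j, h'⟩]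
  refine ⟨δ, fun v w hvw => ?_, fun j v hv => ?_⟩
  · by_cases hv : ∃ j : Fin d → ℤ, Near ρ (v + L • j) 0
    · obtain ⟨j, hj⟩ := hv
      rw [key j v (hj.mono (by omega)),
        key j w (((hvw.symm.add_right (L • j)).trans hj).mono (by omega))]
      exact hη j _ _ (hvw.add_right _)
    · by_cases hw : ∃ j : Fin d → ℤ, Near ρ (w + L • j) 0
      · obtain ⟨j, hj⟩ := hw
        rw [key j w (hj.mono (by omega)),
          key j v (((hvw.add_right (L • j)).trans hj).mono (by omega))]
        exact hη j _ _ (hvw.add_right _)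
      · simp only [δ, dif_neg hv, dif_neg hw]
        exact Near.refl _ _
  · have e : v - L • j + L • j = v := sub_add_cancel _ _
    rw [key j (v - L • j) (by rw [e]; exact hv.mono (by omega)), e]

/-! ### Windows, closed sets and finite type -/

namespace FullShift

variable {d : ℕ} {A : Type u}

theorem vadd_apply (t : Fin d → ℤ) (x : FullShift d A) (s : Fin d → ℤ) : (t +ᵥ x) s = x (s + t) :=
  rfl

theorem isOpen_setOf_forall_eq (S : Finset (Fin d → ℤ)) (w : (Fin d → ℤ) → A) :
    IsOpen {x : FullShift d A | ∀ s ∈ S, x s = w s} := by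
  let _ : TopologicalSpace A := ⊥
  have : DiscreteTopology A := ⟨rfl⟩
  have key : IsOpen {x : (Fin d → ℤ) → A | ∀ s ∈ S, x s = w s} := by
    have e : {x : (Fin d → ℤ) → A | ∀ s ∈ S, x s = w s} =
        ⋂ s ∈ S, (fun x : (Fin d → ℤ) → A => x s) ⁻¹' {w s} := by
      ext x
      simp
    rw [e]
    exact isOpen_biInter_finset fun s _ => (isOpen_discrete {w s}).preimage (continuous_apply s)
  exact key

theorem exists_window_subset {O : Set (FullShift d A)} (hO : IsOpen O) {z : FullShift d A}
    (hz : z ∈ O) : ∃ m : ℕ, ∀ z' : FullShift d A, (∀ v, Near m v 0 → z' v = z v) → z' ∈ O := by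
  let _ : TopologicalSpace A := ⊥
  have : DiscreteTopology A := ⟨rfl⟩
  obtain ⟨I, U, hU, hUO⟩ := isOpen_pi_iff.1 hO z hz
  obtain ⟨m, hm⟩ := exists_near_finset I id
  refine ⟨m, fun z' h => hUO fun s hs => ?_⟩
  rw [h s (hm s hs)]
  exact (hU s hs).2

theorem isClosed_of_windows {C : Set (FullShift d A)}
    (h : ∀ z : FullShift d A, (∀ m : ℕ, ∃ z' ∈ C, ∀ v, Near m v 0 → z' v = z v) → z ∈ C) :
    IsClosed C := by
  refine isClosed_of_closure_subset fun z hz => h z fun m => ?_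
  obtain ⟨z', h1, h2⟩ := mem_closure_iff.1 hz _ (isOpen_setOf_forall_eq (symmBox d m) z)
    fun _ _ => rfl
  exact ⟨z', h2, fun v hv => h1 v (mem_symmBox.2 hv)⟩

end FullShift

theorem Pattern.isOpen_cylinder {d : ℕ} {A : Type u} {S : Finset (Fin d → ℤ)} (w : Pattern A S) :
    IsOpen w.cylinder := by
  classical
  by_cases hA : Nonempty A
  · obtain ⟨a⟩ := hA
    convert FullShift.isOpen_setOf_forall_eq S fun s => if h : s ∈ S then w ⟨s, h⟩ else a using 1
    ext x
    constructor
    · intro h s hs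
      simpa [hs] using h ⟨s, hs⟩
    · intro h s
      simpa [s.2] using h s s.2
  · have : IsEmpty (FullShift d A) := ⟨fun x => hA ⟨x 0⟩⟩
    rw [Set.eq_empty_of_isEmpty w.cylinder]
    exact isOpen_empty

namespace Subshift

variable {d : ℕ} {A : Type u} (X : Subshift d A)

theorem mem_of_windows {x : FullShift d A}
    (h : ∀ m : ℕ, ∃ x' ∈ X.carrier, ∀ v, Near m v 0 → x' v = x v) : x ∈ X.carrier := by
  by_contra hx
  obtain ⟨m, hm⟩ := FullShift.exists_window_subset X.isClosed'.isOpen_compl hx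
  obtain ⟨x', hx', e⟩ := h m
  exact hm x' e hx'

/-- An SFT is determined by the windows of some fixed size. -/
theorem IsSFT.exists_window {X : Subshift d A} (hX : X.IsSFT) : ∃ m : ℕ, ∀ x : FullShift d A,
    (∀ u, ∃ x' ∈ X.carrier, ∀ b, Near m b 0 → x' b = x (u + b)) → x ∈ X.carrier := by
  classical
  obtain ⟨F, hF, hX⟩ := hX
  obtain ⟨m, hm⟩ := exists_near_finset (hF.toFinset.biUnion fun p => p.1) id
  refine ⟨m, fun x h => ?_⟩
  rw [hX]
  rintro p hp ⟨u, hu⟩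
  obtain ⟨x', hx', e⟩ := h u
  rw [hX] at hx'
  refine hx' p hp ⟨0, fun s => ?_⟩
  have hs := e s (hm _ (Finset.mem_biUnion.2 ⟨p, hF.mem_toFinset.2 hp, s.2⟩))
  rw [add_zero, hs, add_comm]
  exact hu s

/-- It suffices to forbid the patterns on the box of radius `M` missing from the language; there are
finitely many since `A` is finite. -/
theorem isSFT_of_window [Finite A] (M : ℕ) (h : ∀ x : FullShift d A,
    (∀ u, ∃ x' ∈ X.carrier, ∀ v, Near M v u → x' v = x v) → x ∈ X.carrier) : X.IsSFT := by
  refine ⟨(fun w => ⟨symmBox d M, w⟩) '' (X.language (symmBox d M))ᶜ, (Set.toFinite _).image _, ?_⟩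
  ext x
  constructor
  · rintro hx _ ⟨w, hw, rfl⟩ happ
    exact hw ⟨x, hx, happ⟩
  · refine fun hx => h x fun u => ?_
    have hw : (fun s : symmBox d M => x (s + u)) ∈ X.language (symmBox d M) := by
      by_contra hw
      exact hx _ ⟨_, hw, rfl⟩ ⟨u, fun _ => rfl⟩
    obtain ⟨x', hx', u', hu'⟩ := hw
    refine ⟨(u' - u) +ᵥ x', X.vadd_mem' _ _ hx', fun v hv => ?_⟩
    have hs : v - u ∈ symmBox d M := mem_symmBox.2 fun i => by
      have := hv i
      simpa using this
    have := hu' ⟨v - u, hs⟩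
    simp only [sub_add_cancel] at this
    rw [← this, FullShift.vadd_apply]
    congr 1
    abel

end Subshift

/-! ### Coding and decoding -/

/-- The alphabet recording a `3 × ⋯ × 3` block of letters and the local gradient of a wobble. -/
abbrev WobbleAlphabet (d : ℕ) (A : Type u) : Type u :=
  (symmBox d 1 → A) × (symmBox d 1 → Fin d → ZMod 3)

/-- The point `x` read along `v ↦ v + δ v`. -/
def wobbleCode {d : ℕ} {A : Type u} (x : FullShift d A) (δ : (Fin d → ℤ) → (Fin d → ℤ)) :
    FullShift d (WobbleAlphabet d A) :=
  fun v => (fun s => x (v + δ v + s), fun t i => ((δ (v + t) i - δ v i : ℤ) : ZMod 3))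

section wobbleCode

variable {d : ℕ} {A : Type u} {x x' : FullShift d A} {δ δ' : (Fin d → ℤ) → (Fin d → ℤ)}

theorem wobbleCode_congr {v v' : Fin d → ℤ}
    (hx : ∀ s, Near 1 s 0 → x (v + δ v + s) = x' (v' + δ' v' + s))
    (hδ : ∀ t, Near 1 t 0 → δ (v + t) - δ v = δ' (v' + t) - δ' v') :
    wobbleCode x δ v = wobbleCode x' δ' v' := by
  refine Prod.ext (funext fun s => hx s (mem_symmBox.1 s.2)) (funext fun t => funext fun i => ?_)
  have := congrFun (hδ t (mem_symmBox.1 t.2)) i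
  exact congrArg (Int.cast : ℤ → ZMod 3) this

theorem vadd_wobbleCode (t : Fin d → ℤ) :
    t +ᵥ wobbleCode x δ = wobbleCode (t +ᵥ x) fun v => δ (v + t) := by
  funext v
  rw [FullShift.vadd_apply]
  refine Prod.ext (funext fun s => ?_) (funext fun s => funext fun i => ?_)
  · simp only [wobbleCode, FullShift.vadd_apply]
    congr 1
    abel
  · simp only [wobbleCode]
    rw [add_right_comm]

theorem wobbleCode_block {v s : Fin d → ℤ} (h : wobbleCode x δ v = wobbleCode x' δ' v)
    (hs : Near 1 s 0) : x (v + δ v + s) = x' (v + δ' v + s) :=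
  congrFun (congrArg Prod.fst h) ⟨s, mem_symmBox.2 hs⟩

/-- Gradients of wobbles between neighbours have coordinates in `{-1, 0, 1}`, which residues mod 3
tell apart. -/
theorem IsWobble.grad_eq (hδ : IsWobble δ) (hδ' : IsWobble δ') {v w : Fin d → ℤ}
    (h : wobbleCode x δ v = wobbleCode x' δ' v) (hw : Near 1 w v) :
    δ w - δ v = δ' w - δ' v := by
  funext i
  have ht : w - v ∈ symmBox d 1 := mem_symmBox.2 fun i => by simpa using hw i
  have e := congrFun (congrFun (congrArg Prod.snd h) ⟨w - v, ht⟩) i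
  simp only [wobbleCode, add_sub_cancel] at e
  rw [ZMod.intCast_eq_intCast_iff_dvd_sub] at e
  have h1 := hδ _ _ (hw.mono one_le_two) i
  have h2 := hδ' _ _ (hw.mono one_le_two) i
  simp only [Pi.sub_apply]
  push_cast at *
  omega

theorem IsWobble.sub_eq_sub (hδ : IsWobble δ) (hδ' : IsWobble δ') {v : Fin d → ℤ} {M : ℕ}
    (h : ∀ u, Near M u v → wobbleCode x δ u = wobbleCode x' δ' u) {w : Fin d → ℤ}
    (hw : Near M w v) : δ w - δ v = δ' w - δ' v :=
  sub_eq_sub_of_grad (fun u hu _ hw => hδ.grad_eq hδ' (h u hu) hw) w hw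

/-- The code determines the point up to a shift. -/
theorem exists_vadd_eq_of_wobbleCode_eq (hδ : IsWobble δ) (hδ' : IsWobble δ')
    (h : wobbleCode x δ = wobbleCode x' δ') : ∃ c : Fin d → ℤ, c +ᵥ x' = x := by
  -- Equal gradients everywhere make `δ' - δ` constant, and this constant is the shift.
  refine ⟨δ' 0 - δ 0, funext fun u => ?_⟩
  obtain ⟨v, hv⟩ := hδ.exists_near_add u
  obtain ⟨M, hM⟩ := exists_near v 0
  have e := hδ.sub_eq_sub hδ' (fun u _ => congrFun h u) hM
  have hs : Near 1 (u - (v + δ v)) 0 := fun i => by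
    have := hv i
    simp only [Pi.sub_apply, Pi.zero_apply]
    omega
  have e' := wobbleCode_block (congrFun h v) hs
  rw [add_sub_cancel] at e'
  rw [e', FullShift.vadd_apply]
  congr 1
  have e2 : δ' v = δ v - δ 0 + δ' 0 := by rw [e]; abel
  rw [e2]
  abel

/-- A configuration whose windows all come from codes of points of `X` is itself a code. -/
theorem exists_wobbleCode_eq (X : Subshift d A) (m : ℕ) (z : FullShift d (WobbleAlphabet d A))
    (h : ∀ v, ∃ x ∈ X.carrier, ∃ δ, IsWobble δ ∧
      ∀ u, Near (2 * m + 6) u v → wobbleCode x δ u = z u) :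
    ∃ x : FullShift d A, ∃ δ, IsWobble δ ∧ wobbleCode x δ = z ∧
      ∀ u, ∃ x' ∈ X.carrier, ∀ b, Near m b 0 → x' b = x (u + b) := by
  choose y hy γ hγ hz using h
  have hloc : ∀ u v w, Near 2 u v → Near 2 w v → γ u w - γ u v = γ v w - γ v v := by
    intro u v w huv hwv
    refine (hγ u).sub_eq_sub (hγ v) (x := y u) (x' := y v) (M := 2) (fun a ha => ?_) hwv
    rw [hz u a ((ha.trans huv.symm).mono (by omega)), hz v a (ha.mono (by omega))]
  obtain ⟨δ, hδ⟩ := exists_potential (fun v w => γ v w - γ v v) fun u v w huv _ hvw => by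
    rw [← hloc u v w huv hvw.symm]
    abel
  -- Points at distance 2 have a midpoint adjacent to both; there `δ` has the gradient of a single
  -- local wobble.
  have hw : IsWobble δ := by
    intro v w hvw
    have h1 := clampTo_near 1 w v
    have h2 : Near 1 v (clampTo 1 w v) := near_clampTo hvw
    have e1 := hδ _ _ h1
    have e2 := hδ _ _ h2.symm
    have h3 := hγ (clampTo 1 w v) _ _ hvw
    intro i
    have h3 := h3 i
    have e1 := congrFun e1 i
    have e2 := congrFun e2 i
    simp only [Pi.sub_apply] at *
    omega
  have hgrad : ∀ v w, Near (2 * m + 6) w v → δ w - δ v = γ v w - γ v v := by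
    intro v
    refine IsWobble.sub_eq_sub_of_grad fun u hu w hw => ?_
    rw [hδ u w hw.symm]
    refine (hγ u).grad_eq (hγ v) (x := y u) (x' := y v) ?_ hw
    rw [hz u u (Near.refl _ _), hz v u hu]
  -- `V u` is a site whose block covers `u`; the value of `x` at `u` is read off there.
  choose V hV using hw.exists_near_add
  have hs : ∀ u, u - (V u + δ (V u)) ∈ symmBox d 1 := fun u => mem_symmBox.2 fun i => by
    have := hV u i
    simp only [Pi.sub_apply, Pi.zero_apply]
    omega
  let x : FullShift d A := fun u => (z (V u)).1 ⟨_, hs u⟩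
  -- The value does not depend on the site. Coarse injectivity with `r = m + 2` puts `V u` within `2
  -- * m + 6` of `v`, whence the window size.
  have hx : ∀ u v, Near (m + 1) u (v + δ v) → x u = y v (u + (γ v v - δ v)) := by
    intro u v huv
    have hn : Near (2 * m + 6) (V u) v :=
      (hw.near_of_near ((hV u).trans huv)).mono (by omega)
    have e : (z (V u)).1 ⟨_, hs u⟩ = y v (V u + γ v (V u) + (u - (V u + δ (V u)))) := by
      rw [← hz v _ hn]
      rfl
    change (z (V u)).1 ⟨_, hs u⟩ = _
    rw [e]
    congr 1
    have e2 := hgrad v _ hn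
    rw [sub_eq_iff_eq_add] at e2
    rw [e2]
    abel
  refine ⟨x, δ, hw, ?_, fun u => ?_⟩
  · funext v
    rw [← hz v v (Near.refl _ _)]
    refine wobbleCode_congr (fun s hs => ?_) fun t ht => ?_
    · rw [hx _ v]
      · congr 1
        abel
      · exact fun i => by
          have := hs i
          simp only [Pi.add_apply, Pi.zero_apply] at *
          omega
    · refine hgrad v _ fun i => ?_
      have := ht i
      simp only [Pi.add_apply, Pi.zero_apply] at *
      omega
  · refine ⟨(u + (γ (V u) (V u) - δ (V u))) +ᵥ y (V u), X.vadd_mem' _ _ (hy _), fun b hb => ?_⟩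
    rw [hx (u + b) (V u), FullShift.vadd_apply]
    · congr 1
      abel
    · intro i
      have := hb i
      have := hV u i
      simp only [Pi.add_apply, Pi.zero_apply] at *
      omega

end wobbleCode

/-! ### The subshift of codes -/

/-- The codes of the points of a set. -/
def wobbleSet {d : ℕ} {A : Type u} (O : Set (FullShift d A)) :
    Set (FullShift d (WobbleAlphabet d A)) :=
  {z | ∃ x ∈ O, ∃ δ, IsWobble δ ∧ wobbleCode x δ = z}

theorem vadd_mem_wobbleSet {d : ℕ} {A : Type u} {O : Set (FullShift d A)}
    (hO : ∀ (t : Fin d → ℤ), ∀ x ∈ O, t +ᵥ x ∈ O) (t : Fin d → ℤ)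
    {z : FullShift d (WobbleAlphabet d A)} (hz : z ∈ wobbleSet O) : t +ᵥ z ∈ wobbleSet O := by
  obtain ⟨x, hx, δ, hδ, rfl⟩ := hz
  exact ⟨t +ᵥ x, hO t x hx, _, hδ.comp_add t, (vadd_wobbleCode t).symm⟩

namespace Subshift

variable {d : ℕ} {A : Type u} (X : Subshift d A)

/-- The subshift of all codes of points of `X`. -/
def wobble : Subshift d (WobbleAlphabet d A) where
  carrier := wobbleSet X.carrier
  nonempty' := by
    obtain ⟨x, hx⟩ := X.nonempty'
    exact ⟨_, x, hx, 0, IsWobble.zero, rfl⟩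
  isClosed' := by
    refine FullShift.isClosed_of_windows fun z hz => ?_
    have key : ∀ m : ℕ, ∀ v, ∃ x ∈ X.carrier, ∃ δ, IsWobble δ ∧
        ∀ u, Near (2 * m + 6) u v → wobbleCode x δ u = z u := by
      intro m v
      obtain ⟨k, hk⟩ := exists_near v 0
      obtain ⟨_, ⟨x, hx, δ, hδ, rfl⟩, e⟩ := hz (2 * m + 6 + k)
      exact ⟨x, hx, δ, hδ, fun u hu => e u (hu.trans hk)⟩
    -- Decode once to fix `x`. Decoding again for each `m` gives a point with legal `m`-windows,
    -- which is a shift of `x`; so all windows of `x` are legal.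
    obtain ⟨x, δ, hδ, rfl, -⟩ := exists_wobbleCode_eq X 0 z (key 0)
    refine ⟨x, X.mem_of_windows fun m => ?_, δ, hδ, rfl⟩
    obtain ⟨x', δ', hδ', e, hx'⟩ := exists_wobbleCode_eq X m _ (key m)
    obtain ⟨c, rfl⟩ := exists_vadd_eq_of_wobbleCode_eq hδ hδ' e.symm
    obtain ⟨y, hy, e⟩ := hx' c
    refine ⟨y, hy, fun v hv => ?_⟩
    rw [e v hv, FullShift.vadd_apply, add_comm]
  vadd_mem' t z hz := vadd_mem_wobbleSet X.vadd_mem' t hz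

theorem IsSFT.wobble [Finite A] {X : Subshift d A} (hX : X.IsSFT) : X.wobble.IsSFT := by
  obtain ⟨m, hm⟩ := hX.exists_window
  refine X.wobble.isSFT_of_window (2 * m + 6) fun z hz => ?_
  obtain ⟨x, δ, hδ, rfl, hx⟩ := exists_wobbleCode_eq X m z fun v => by
    obtain ⟨_, ⟨x, hx, δ, hδ, rfl⟩, e⟩ := hz v
    exact ⟨x, hx, δ, hδ, e⟩
  exact ⟨x, hm x hx, δ, hδ, rfl⟩

end Subshift

/-! ### Entropy from independence -/

section Entropy

variable {d : ℕ} {Y : Type u} [AddAction (Fin d → ℤ) Y]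

/-- Ensures that the infimum in `minSubcoverCard` is over a nonempty set, so that it is attained and
is not the default value 0. -/
theorem exists_finset_subcover_joinCover {U V : Set Y} (hUV : U ∪ V = univ)
    (S : Finset (Fin d → ℤ)) : ∃ 𝒱 : Finset (Set Y),
      (𝒱 : Set (Set Y)) ⊆ joinCover S {U, V} ∧ ⋃₀ (𝒱 : Set (Set Y)) = univ := by
  classical
  refine ⟨S.powerset.image fun T => ⋂ v ∈ S, (fun x : Y => v +ᵥ x) '' (if v ∈ T then U else V),
    ?_, ?_⟩
  · intro W hW
    obtain ⟨T, -, rfl⟩ := Finset.mem_image.1 (Finset.mem_coe.1 hW)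
    refine ⟨fun v => if v ∈ T then U else V, fun v _ => ?_, rfl⟩
    by_cases hv : v ∈ T <;> simp [hv]
  · refine Set.eq_univ_of_forall fun y => ?_
    refine ⟨_, Finset.mem_coe.2 (Finset.mem_image_of_mem _
      (Finset.mem_powerset.2 (Finset.filter_subset (fun v : Fin d → ℤ => -v +ᵥ y ∈ U) S))), ?_⟩
    refine Set.mem_iInter₂.2 fun v hv => ⟨-v +ᵥ y, ?_, vadd_neg_vadd v y⟩
    by_cases h : -v +ᵥ y ∈ U
    · simp [hv, h]
    · have : -v +ᵥ y ∈ V := (hUV ▸ mem_univ (-v +ᵥ y) : -v +ᵥ y ∈ U ∪ V).resolve_left h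
      simpa [h] using this

/-- Points for distinct subsets of `D` lie in distinct members of a subcover: where the subsets
differ, a factor `U` excludes one point and a factor `V` the other. -/
theorem two_pow_card_le_minSubcoverCard {U V : Set Y} (hUV : U ∪ V = univ)
    {S D : Finset (Fin d → ℤ)} {e : (Fin d → ℤ) → (Fin d → ℤ)} (he : ∀ j ∈ D, e j ∈ S)
    (h : ∀ G : Finset (Fin d → ℤ), ∃ y : Y, ∀ j ∈ D,
      (j ∈ G → -e j +ᵥ y ∉ U) ∧ (j ∉ G → -e j +ᵥ y ∉ V)) :
    2 ^ D.card ≤ minSubcoverCard (joinCover S {U, V}) := by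
  classical
  obtain ⟨𝒱₀, h₀, h₀'⟩ := exists_finset_subcover_joinCover hUV S
  obtain ⟨𝒱, h𝒱, hcov, hcard⟩ := Nat.sInf_mem (s := {k | ∃ 𝒱 : Finset (Set Y),
    (𝒱 : Set (Set Y)) ⊆ joinCover S {U, V} ∧ ⋃₀ (𝒱 : Set (Set Y)) = univ ∧ 𝒱.card = k})
    ⟨_, 𝒱₀, h₀, h₀', rfl⟩
  choose y hy using h
  have hW : ∀ G, ∃ W ∈ 𝒱, y G ∈ W := fun G => by
    have : y G ∈ ⋃₀ (𝒱 : Set (Set Y)) := hcov ▸ mem_univ _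
    exact this
  choose W hW𝒱 hyW using hW
  have key : ∀ G G', W G = W G' → ∀ j ∈ D, j ∈ G → j ∈ G' := by
    intro G G' hGG' j hj hjG
    by_contra hjG'
    obtain ⟨T, hT, e1⟩ := h𝒱 (hW𝒱 G)
    have hG := hyW G
    have hG' := hyW G'
    rw [← hGG'] at hG'
    rw [e1] at hG hG'
    obtain ⟨a, ha, hay⟩ := Set.mem_iInter₂.1 hG (e j) (he j hj)
    obtain ⟨b, hb, hby⟩ := Set.mem_iInter₂.1 hG' (e j) (he j hj)
    have ha' : -e j +ᵥ y G = a := by rw [← hay]; exact neg_vadd_vadd _ _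
    have hb' : -e j +ᵥ y G' = b := by rw [← hby]; exact neg_vadd_vadd _ _
    rcases hT (e j) (he j hj) with h | h
    · exact (hy G j hj).1 hjG (by rw [ha', ← h]; exact ha)
    · exact (hy G' j hj).2 hjG' (by rw [hb', ← (h : T (e j) = V)]; exact hb)
  have hle : D.powerset.card ≤ 𝒱.card := by
    refine Finset.card_le_card_of_injOn W (fun G _ => hW𝒱 G) fun G hG G' hG' hGG' => ?_
    have hG := Finset.mem_powerset.1 (Finset.mem_coe.1 hG)
    have hG' := Finset.mem_powerset.1 (Finset.mem_coe.1 hG')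
    ext j
    exact ⟨fun hj => key G G' hGG' j (hG hj) hj, fun hj => key G' G hGG'.symm j (hG' hj) hj⟩
  rw [Finset.card_powerset] at hle
  exact hle.trans hcard.le

/-- Independence along a set of positions of positive density forces positive entropy. -/
theorem topEntropy_pos [TopologicalSpace Y] {U V : Set Y} (hU : IsOpen U) (hV : IsOpen V)
    (hUV : U ∪ V = univ) {L : ℕ} (hL : 0 < L) {ε : ℝ} (hε : 0 < ε)
    (h : ∀ k : ℕ, ∃ D ⊆ posBox d k, ε * (k : ℝ) ^ d ≤ D.card ∧
      ∀ G : Finset (Fin d → ℤ), ∃ y : Y, ∀ j ∈ D,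
        (j ∈ G → -(L • j) +ᵥ y ∉ U) ∧ (j ∉ G → -(L • j) +ᵥ y ∉ V)) :
    0 < topEntropy d Y := by
  have hc : 0 < ε * Real.log 2 / (L : ℝ) ^ d := by
    have := Real.log_pos one_lt_two
    positivity
  refine lt_of_lt_of_le (EReal.coe_pos.2 hc) ?_
  have hcov : IsOpenCoverFamily ({U, V} : Set (Set Y)) := by
    refine ⟨?_, by rw [sUnion_pair, hUV]⟩
    rintro W (rfl | rfl)
    exacts [hU, hV]
  refine le_trans ?_ (le_iSup₂ (f := fun (𝒰 : Set (Set Y)) (_ : IsOpenCoverFamily 𝒰) =>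
    limsup (fun n : ℕ =>
      ((Real.log (minSubcoverCard (joinCover (posBox d n) 𝒰)) / (n : ℝ) ^ d : ℝ) : EReal)) atTop)
    {U, V} hcov)
  refine le_limsup_of_frequently_le ?_
  -- Sizes divisible by `L` suffice for an upper limit; dilating the positions by `L` costs a factor
  -- `L ^ d` in density.
  refine frequently_atTop.2 fun N => ⟨L * (N + 1), ?_, EReal.coe_le_coe_iff.2 ?_⟩
  · exact (Nat.le_succ N).trans (Nat.le_mul_of_pos_left _ hL)
  obtain ⟨D, hD, hcard, hind⟩ := h (N + 1)
  have hS : ∀ j ∈ D, L • j ∈ posBox d (L * (N + 1)) := by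
    intro j hj
    have hj := Finset.mem_Icc.1 (hD hj)
    refine Finset.mem_Icc.2 ⟨fun i => ?_, fun i => ?_⟩
    · have := hj.1 i
      simp only [Pi.smul_apply, nsmul_eq_mul]
      have : (1 : ℤ) ≤ L := by exact_mod_cast hL
      nlinarith
    · have := hj.2 i
      simp only [Pi.smul_apply, nsmul_eq_mul]
      push_cast at *
      exact mul_le_mul_of_nonneg_left this (Int.natCast_nonneg _)
  have h2 := two_pow_card_le_minSubcoverCard hUV hS hind
  have h3 : (D.card : ℝ) * Real.log 2 ≤
      Real.log (minSubcoverCard (joinCover (posBox d (L * (N + 1))) ({U, V} : Set (Set Y)))) := by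
    rw [← Real.log_pow]
    exact Real.log_le_log (by positivity) (by exact_mod_cast h2)
  have hlog := Real.log_pos one_lt_two
  have hLpos : (0 : ℝ) < (L : ℝ) := by exact_mod_cast hL
  have hNpos : (0 : ℝ) < ((N + 1 : ℕ) : ℝ) := by positivity
  rw [Nat.cast_mul, mul_pow, div_le_div_iff₀ (by positivity) (by positivity)]
  calc ε * Real.log 2 * ((L : ℝ) ^ d * ((N + 1 : ℕ) : ℝ) ^ d)
      = (ε * ((N + 1 : ℕ) : ℝ) ^ d * Real.log 2) * (L : ℝ) ^ d := by ring
    _ ≤ _ := by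
      refine mul_le_mul_of_nonneg_right (le_trans ?_ h3) (by positivity)
      exact mul_le_mul_of_nonneg_right hcard hlog.le

end Entropy

/-! ### Independent choices in codes -/

theorem card_posBox (d k : ℕ) : (posBox d k).card = k ^ d := by
  simp [posBox, Pi.card_Icc]

/-- A point of `X` in which an event occurs at least as often as on average. -/
theorem Subshift.exists_dense_positions {d : ℕ} {A : Type u} (X : Subshift d A)
    {μ : Measure (FullShift d A)} (hμ : μ ∈ X.invariantMeasures) {C : Set (FullShift d A)}
    (hC : MeasurableSet C) (L k : ℕ) : ∃ x ∈ X.carrier, ∃ D ⊆ posBox d k,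
      μ.real C * (k : ℝ) ^ d ≤ D.card ∧ ∀ j ∈ D, -(L • j) +ᵥ x ∈ C := by
  classical
  obtain ⟨hprob, hX, hinv⟩ := hμ
  let E : (Fin d → ℤ) → Set (FullShift d A) := fun j => (fun x => -(L • j) +ᵥ x) ⁻¹' C
  have hE : ∀ j, MeasurableSet (E j) := fun j => (hinv _).measurable hC
  have hint : ∀ j, Integrable ((E j).indicator fun _ => (1 : ℝ)) μ := fun j =>
    (integrable_const _).indicator (hE j)
  -- By invariance the mean number of occurrences is `μ.real C * k ^ d`; some point off the null
  -- complement of `X` attains at least the mean.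
  obtain ⟨x, hx, hle⟩ := exists_notMem_null_integral_le
    (f := fun x => ∑ j ∈ posBox d k, (E j).indicator (fun _ => (1 : ℝ)) x)
    (integrable_finsetSum _ fun j _ => hint j) hX
  refine ⟨x, not_not.1 hx, (posBox d k).filter fun j => x ∈ E j, Finset.filter_subset _ _, ?_,
    fun j hj => (Finset.mem_filter.1 hj).2⟩
  rw [integral_finsetSum _ fun j _ => hint j] at hle
  have h1 : ∀ j, ∫ a, (E j).indicator (fun _ => (1 : ℝ)) a ∂μ = μ.real C := fun j => by
    rw [integral_indicator_const _ (hE j), smul_eq_mul, mul_one, measureReal_def, measureReal_def,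
      (hinv _).measure_preimage hC.nullMeasurableSet]
  simp only [h1, Finset.sum_const, card_posBox, nsmul_eq_mul] at hle
  simp only [Set.indicator_apply, Finset.sum_boole] at hle
  rw [mul_comm]
  exact_mod_cast hle

/-- All central windows of `x` and `x'` coexist in points of `X`. -/
def Subshift.WindowsCoexist {d : ℕ} {A : Type u} (X : Subshift d A) (x x' : FullShift d A) : Prop :=
  ∀ n : ℕ, ∃ y ∈ X.carrier, ∃ p q : Fin d → ℤ, ∀ s, Near n s 0 → y (s + p) = x s ∧ y (s + q) = x' s

theorem Subshift.WindowsCoexist.refl {d : ℕ} {A : Type u} {X : Subshift d A} {x : FullShift d A}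
    (hx : x ∈ X.carrier) : X.WindowsCoexist x x :=
  fun _ => ⟨x, hx, 0, 0, fun s _ => by simp⟩

/-- Windows of codes of coexisting points can be chosen independently at positive density. -/
theorem Subshift.WindowsCoexist.exists_independent {d : ℕ} {A : Type u} {X : Subshift d A}
    {x x' : FullShift d A} (h : X.WindowsCoexist x x') (hX : X.PatternsHavePositiveMeasure)
    {δ δ' : (Fin d → ℤ) → (Fin d → ℤ)} (hδ : IsWobble δ) (hδ' : IsWobble δ') (m : ℕ) :
    ∃ L : ℕ, 0 < L ∧ ∃ ε : ℝ, 0 < ε ∧ ∀ k : ℕ, ∃ D ⊆ posBox d k, ε * (k : ℝ) ^ d ≤ D.card ∧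
      ∀ G : Finset (Fin d → ℤ), ∃ z ∈ X.wobble.carrier, ∀ j ∈ D, ∀ v, Near m v 0 →
        (j ∈ G → (-(L • j) +ᵥ z) v = wobbleCode x δ v) ∧
        (j ∉ G → (-(L • j) +ᵥ z) v = wobbleCode x' δ' v) := by
  classical
  obtain ⟨b, hb⟩ := exists_near_finset (symmBox d m) fun v => v + δ v
  obtain ⟨b', hb'⟩ := exists_near_finset (symmBox d m) fun v => v + δ' v
  obtain ⟨y, hy, p, q, hpq⟩ := h (b + b' + 1)
  -- Adding `p` to `δ` makes `y` read as `x` along `δ`. Radius `m + 1` is kept because codes record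
  -- gradients to neighbours.
  obtain ⟨ρ, η, hη, hηm, hη0⟩ := (hδ.add_const p).exists_flatten (m + 1)
  obtain ⟨ρ', η', hη', hηm', hη0'⟩ := (hδ'.add_const q).exists_flatten (m + 1)
  obtain ⟨c, hc⟩ := exists_near p 0
  obtain ⟨c', hc'⟩ := exists_near q 0
  let K := b + b' + 1 + c + c'
  let w : Pattern A (symmBox d K) := fun s => y s
  obtain ⟨μ, hμ, hpos⟩ := hX (symmBox d K) w ⟨y, hy, 0, fun s => by rw [add_zero]⟩
  have hprob := hμ.1
  let R := ρ + ρ' + m + 1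
  refine ⟨2 * R + 3, by omega, μ.real w.cylinder, ENNReal.toReal_pos hpos.ne' (measure_ne_top _ _),
    fun k => ?_⟩
  obtain ⟨x₁, hx₁, D, hD, hcard, hDw⟩ :=
    X.exists_dense_positions hμ w.isOpen_cylinder.measurableSet (2 * R + 3) k
  refine ⟨D, hD, hcard, fun G => ?_⟩
  -- Only the wobble depends on `G`; the underlying point `x₁` does not.
  obtain ⟨γ, hγ, hγη⟩ := IsWobble.exists_glue (ρ := R) (L := 2 * R + 3) (by omega)
    (fun j => if j ∈ G then η else η') (fun j => by split_ifs <;> assumption)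
    (fun j v hv => by
      split_ifs
      · exact hη0 v fun h => hv (h.mono (by omega))
      · exact hη0' v fun h => hv (h.mono (by omega)))
  refine ⟨_, ⟨x₁, hx₁, γ, hγ, rfl⟩, fun j hj v hv => ?_⟩
  have hw : ∀ s, Near K s 0 → x₁ (s - (2 * R + 3) • j) = y s := fun s hs => by
    have := hDw j hj ⟨s, mem_symmBox.2 hs⟩
    rwa [FullShift.vadd_apply, ← sub_eq_add_neg] at this
  have main : ∀ (x₂ : FullShift d A) (δ₂ η₂ : (Fin d → ℤ) → Fin d → ℤ) (r : Fin d → ℤ),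
      Near (b + b') (v + δ₂ v) 0 → Near (c + c') r 0 →
      (∀ s, Near (b + b' + 1) s 0 → y (s + r) = x₂ s) →
      (∀ v, Near (m + 1) v 0 → η₂ v = δ₂ v + r) →
      (∀ v, Near R v 0 → γ (v - (2 * R + 3) • j) = η₂ v) →
      (-((2 * R + 3) • j) +ᵥ wobbleCode x₁ γ) v = wobbleCode x₂ δ₂ v := by
    intro x₂ δ₂ η₂ r hv2 hr hyr hη2 hγ2
    have hγv : ∀ t, Near 1 t 0 → γ (v - (2 * R + 3) • j + t) = δ₂ (v + t) + r := by
      intro t ht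
      have hvt : Near (m + 1) (v + t) 0 := fun i => by
        have := hv i
        have := ht i
        simp only [Pi.add_apply, Pi.zero_apply] at *
        omega
      rw [← hη2 _ hvt, ← hγ2 _ (hvt.mono (by omega))]
      congr 1
      abel
    have hγ0 : γ (v - (2 * R + 3) • j) = δ₂ v + r := by
      simpa using hγv 0 (Near.refl _ _)
    rw [FullShift.vadd_apply, ← sub_eq_add_neg]
    refine wobbleCode_congr (fun s hs => ?_) fun t ht => ?_
    · have hs2 : Near (b + b' + 1) (v + δ₂ v + s) 0 := fun i => by
        have := hv2 i
        have := hs i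
        simp only [Pi.add_apply, Pi.zero_apply] at *
        omega
      rw [← hyr _ hs2, ← hw, hγ0]
      · congr 1
        abel
      · intro i
        have := hs2 i
        have := hr i
        simp only [Pi.add_apply, Pi.zero_apply, K] at *
        omega
    · rw [hγv t ht, hγ0]
      abel
  constructor
  · intro hjG
    refine main x δ η p ((hb v (mem_symmBox.2 hv)).mono (by omega)) (hc.mono (by omega))
      (fun s hs => (hpq s hs).1) hηm fun v hv => ?_
    rw [hγη j v hv, if_pos hjG]
  · intro hjG
    refine main x' δ' η' q ((hb' v (mem_symmBox.2 hv)).mono (by omega)) (hc'.mono (by omega))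
      (fun s hs => (hpq s hs).2) hηm' fun v hv => ?_
    rw [hγη j v hv, if_neg hjG]

/-- A zero entropy factor does not separate codes of coexisting points. -/
theorem Subshift.WindowsCoexist.factor_eq {d : ℕ} {A : Type u} {X : Subshift d A}
    {x x' : FullShift d A} (h : X.WindowsCoexist x x') (hX : X.PatternsHavePositiveMeasure)
    {Y : Type u} [MetricSpace Y] [AddAction (Fin d → ℤ) Y] (hY : ¬ 0 < topEntropy d Y)
    {φ : X.wobble.carrier → Y} (hφ : Continuous φ)
    (hequiv : ∀ (v : Fin d → ℤ) (z : X.wobble.carrier), φ (v +ᵥ z) = v +ᵥ φ z)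
    {z z' : X.wobble.carrier} {δ δ' : (Fin d → ℤ) → (Fin d → ℤ)} (hδ : IsWobble δ)
    (hδ' : IsWobble δ') (hz : (z : FullShift d _) = wobbleCode x δ)
    (hz' : (z' : FullShift d _) = wobbleCode x' δ') : φ z = φ z' := by
  by_contra hne
  obtain ⟨r, hr, hdist⟩ : ∃ r : ℝ, 0 < r ∧ 2 * r < dist (φ z) (φ z') :=
    ⟨dist (φ z) (φ z') / 3, by have := dist_pos.2 hne; linarith,
      by have := dist_pos.2 hne; linarith⟩
  have hwin : ∀ a : X.wobble.carrier, ∃ m : ℕ, ∀ b : X.wobble.carrier,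
      (∀ v, Near m v 0 → b.1 v = a.1 v) →
      dist (φ b) (φ a) < r := by
    intro a
    obtain ⟨O, hO, e⟩ := isOpen_induced_iff.1
      ((Metric.isOpen_ball (x := φ a) (ε := r)).preimage hφ)
    have ha : a ∈ Subtype.val ⁻¹' O := by
      rw [e]
      exact Metric.mem_ball_self hr
    obtain ⟨m, hm⟩ := FullShift.exists_window_subset hO ha
    refine ⟨m, fun b hb => ?_⟩
    have hb' : b ∈ Subtype.val ⁻¹' O := hm b hb
    rw [e] at hb'
    exact hb'
  obtain ⟨m, hm⟩ := hwin z
  obtain ⟨m', hm'⟩ := hwin z'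
  obtain ⟨L, hL, ε, hε, hind⟩ := h.exists_independent hX hδ hδ' (m + m')
  -- Complements of closed `r`-balls about the two images; they cover because `2 * r` is less than
  -- the distance.
  refine hY (topEntropy_pos (U := {y | r < dist y (φ z)}) (V := {y | r < dist y (φ z')})
    (isOpen_lt continuous_const (continuous_id.dist continuous_const))
    (isOpen_lt continuous_const (continuous_id.dist continuous_const)) ?_ hL hε fun k => ?_)
  · refine Set.eq_univ_of_forall fun y => ?_
    by_contra hy
    simp only [mem_union, mem_ofPred_eq, not_or, not_lt] at hy
    have := dist_triangle_left (φ z) (φ z') y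
    linarith
  · obtain ⟨D, hD, hcard, hG⟩ := hind k
    refine ⟨D, hD, hcard, fun G => ?_⟩
    obtain ⟨a, ha, hav⟩ := hG G
    refine ⟨φ ⟨a, ha⟩, fun j hj => ⟨fun hjG (hlt : r < dist _ (φ z)) => lt_asymm hlt ?_,
      fun hjG (hlt : r < dist _ (φ z')) => lt_asymm hlt ?_⟩⟩
    · rw [← hequiv]
      refine hm _ fun v hv => ?_
      rw [hz]
      exact (hav j hj v (hv.mono (by omega))).1 hjG
    · rw [← hequiv]
      refine hm' _ fun v hv => ?_
      rw [hz']
      exact (hav j hj v (hv.mono (by omega))).2 hjG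

/-! ### Chains of points and the conclusion -/

/-- Chains of coexisting windows of bounded length converge to chains of points. -/
theorem Subshift.UniformlyChainCoexistent.exists_chain {d : ℕ} {A : Type u} [Finite A]
    {X : Subshift d A} (h : X.UniformlyChainCoexistent) :
    ∃ N : ℕ, 1 ≤ N ∧ ∀ x ∈ X.carrier, ∀ x' ∈ X.carrier, ∃ c : ℕ → FullShift d A,
      c 1 = x ∧ c N = x' ∧ (∀ i, 1 ≤ i → i ≤ N → c i ∈ X.carrier) ∧
      ∀ i, 1 ≤ i → i < N → X.WindowsCoexist (c i) (c (i + 1)) := by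
  classical
  obtain ⟨N, hN, h⟩ := h
  refine ⟨N, hN, fun x hx x' hx' => ?_⟩
  have hmem : ∀ y ∈ X.carrier, ∀ n,
      (fun s : symmBox d n => y (s : Fin d → ℤ)) ∈ X.language (symmBox d n) :=
    fun y hy n => ⟨y, hy, 0, fun s => by rw [add_zero]⟩
  choose w hw1 hwN hwX hwc using fun n => h n _ (hmem x hx n) _ (hmem x' hx' n)
  -- The value outside the box is immaterial, as each site eventually lies in the box.
  let y : ℕ → ℕ → FullShift d A := fun n i s =>
    if hs : s ∈ symmBox d n then w n i ⟨s, hs⟩ else x s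
  -- One ultrafilter gives limits for all links at once, since `A` is finite; the length `N` is the
  -- same for all `n`.
  let 𝒰 : Ultrafilter ℕ := hyperfilter ℕ
  have hlim : ∀ i s, ∃ a, ∀ᶠ n in (𝒰 : Filter ℕ), y n i s = a := by
    intro i s
    exact 𝒰.eventually_exists_iff.1 (Eventually.of_forall fun n => ⟨y n i s, rfl⟩)
  choose c hc using hlim
  have hbox : ∀ i m, ∀ᶠ n in (𝒰 : Filter ℕ), m ≤ n ∧ ∀ s, Near m s 0 →
      ∃ hs : s ∈ symmBox d n, w n i ⟨s, hs⟩ = c i s := by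
    intro i m
    have h1 : ∀ᶠ n in (𝒰 : Filter ℕ), m ≤ n :=
      (eventually_ge_atTop m).filter_mono Nat.hyperfilter_le_atTop
    have h2 := (Filter.eventually_all_finset (symmBox d m)).2 fun s _ => hc i s
    filter_upwards [h1, h2] with n hn hs
    refine ⟨hn, fun s hsm => ?_⟩
    have hmem : s ∈ symmBox d n := mem_symmBox.2 (hsm.mono hn)
    have e := hs s (mem_symmBox.2 hsm)
    simp only [y, dif_pos hmem] at e
    exact ⟨hmem, e⟩
  refine ⟨c, ?_, ?_, fun i hi hiN => ?_, fun i hi hiN m => ?_⟩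
  · funext s
    obtain ⟨m, hm⟩ := exists_near s 0
    obtain ⟨n, -, hn⟩ := (hbox 1 m).exists
    obtain ⟨hs, e⟩ := hn s hm
    rw [← e, hw1]
  · funext s
    obtain ⟨m, hm⟩ := exists_near s 0
    obtain ⟨n, -, hn⟩ := (hbox N m).exists
    obtain ⟨hs, e⟩ := hn s hm
    rw [← e, hwN]
  · refine X.mem_of_windows fun m => ?_
    obtain ⟨n, -, hn⟩ := (hbox i m).exists
    obtain ⟨z, hz, v, hv⟩ := hwX n i hi hiN
    refine ⟨v +ᵥ z, X.vadd_mem' v z hz, fun s hs => ?_⟩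
    obtain ⟨hs, e⟩ := hn s hs
    rw [FullShift.vadd_apply, ← e, hv ⟨s, hs⟩]
  · obtain ⟨n, ⟨-, hn⟩, -, hn'⟩ := ((hbox i m).and (hbox (i + 1) m)).exists
    obtain ⟨z, hz, ⟨p, hp⟩, q, hq⟩ := hwc n i hi hiN
    refine ⟨z, hz, p, q, fun s hs => ?_⟩
    obtain ⟨hs1, e1⟩ := hn s hs
    obtain ⟨hs2, e2⟩ := hn' s hs
    rw [← e1, ← e2]
    exact ⟨hp ⟨s, hs1⟩, hq ⟨s, hs2⟩⟩

/-- A zero entropy factor is constant along a chain of points. The reflexive case of `factor_eq`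
identifies all codes of one point, so the choice of wobble at each link is free. -/
theorem Subshift.hasTCPE_wobble {d : ℕ} {A : Type u} [Finite A] (X : Subshift d A)
    (hX : X.PatternsHavePositiveMeasure) (hc : X.UniformlyChainCoexistent) :
    HasTCPE d X.wobble.carrier := by
  intro Y _ _ _ _ φ hφ hsurj hequiv
  by_contra hcon
  obtain ⟨hY, hcard⟩ := not_or.1 hcon
  obtain ⟨N, hN, hchain⟩ := hc.exists_chain
  refine hcard (Nat.card_eq_one_iff_unique.2 ⟨⟨fun a b => ?_⟩, ?_⟩)
  · obtain ⟨⟨_, x, hx, δ, hδ, rfl⟩, rfl⟩ := hsurj a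
    obtain ⟨⟨_, x', hx', δ', hδ', rfl⟩, rfl⟩ := hsurj b
    obtain ⟨c, rfl, rfl, hcX, hcc⟩ := hchain x hx x' hx'
    have key : ∀ i, 1 ≤ i → i ≤ N → ∀ γ, IsWobble γ → ∀ z : X.wobble.carrier,
        (z : FullShift d _) = wobbleCode (c i) γ →
        φ ⟨wobbleCode (c 1) δ, c 1, hx, δ, hδ, rfl⟩ = φ z := by
      intro i hi
      induction i, hi using Nat.le_induction with
      | base =>
        intro _ γ hγ z hz
        exact (WindowsCoexist.refl hx).factor_eq hX hY hφ hequiv hδ hγ rfl hz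
      | succ i hi ih =>
        intro hiN γ hγ z hz
        have hi' : i ≤ N := by omega
        rw [ih hi' 0 IsWobble.zero ⟨_, c i, hcX i hi hi', 0, IsWobble.zero, rfl⟩ rfl]
        exact (hcc i hi hiN).factor_eq hX hY hφ hequiv IsWobble.zero hγ rfl hz
    exact key N hN le_rfl δ' hδ' _ rfl
  · obtain ⟨z, hz⟩ := X.wobble.nonempty'
    exact ⟨φ ⟨z, hz⟩⟩

/-- The map `f` is only ever applied to orbits `O(x) = AddAction.orbit (Fin d → ℤ) x`;
`f(X)` is the union of the sets `f(O(x))`, `x ∈ X`. -/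
theorem mainTheorem4 (d : ℕ) (hd : d ≤ 2) (A : Type u) [Finite A] :
    ∃ (B : Type u) (_ : Finite B) (f : Set (FullShift d A) → Set (FullShift d B)),
      -- `f` takes every orbit to a (nonempty) union of orbits
      (∀ x : FullShift d A, ∃ P : Set (FullShift d B), P.Nonempty ∧
        f (AddAction.orbit (Fin d → ℤ) x) = ⋃ z ∈ P, AddAction.orbit (Fin d → ℤ) z) ∧
      -- distinct orbits have disjoint images
      (∀ x x' : FullShift d A,
        AddAction.orbit (Fin d → ℤ) x ≠ AddAction.orbit (Fin d → ℤ) x' →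
        f (AddAction.orbit (Fin d → ℤ) x) ∩ f (AddAction.orbit (Fin d → ℤ) x') = ∅) ∧
      ∀ X : Subshift d A, ∃ Z : Subshift d B,
        -- `f(X)` is a subshift `Z`, and an SFT if `X` is
        Z.carrier = (⋃ x ∈ X.carrier, f (AddAction.orbit (Fin d → ℤ) x)) ∧
        (X.IsSFT → Z.IsSFT) ∧
        -- under the two transitivity conditions, `f(X)` has TCPE
        (X.PatternsHavePositiveMeasure → X.UniformlyChainCoexistent →
          HasTCPE d Z.carrier) := by
  refine ⟨WobbleAlphabet d A, inferInstance, wobbleSet, fun x => ?_, fun x x' hne => ?_, fun X =>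
    ⟨X.wobble, ?_, Subshift.IsSFT.wobble, X.hasTCPE_wobble⟩⟩
  · refine ⟨wobbleSet (AddAction.orbit (Fin d → ℤ) x),
      ⟨_, x, AddAction.mem_orbit_self x, 0, IsWobble.zero, rfl⟩, Subset.antisymm ?_ ?_⟩
    · exact fun z hz => mem_biUnion hz (AddAction.mem_orbit_self z)
    · refine iUnion₂_subset fun z hz => ?_
      rintro _ ⟨t, rfl⟩
      exact vadd_mem_wobbleSet (fun t y hy => AddAction.mem_orbit_of_mem_orbit t hy) t hz
  · rw [Set.eq_empty_iff_forall_notMem]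
    rintro _ ⟨⟨y, hy, δ, hδ, rfl⟩, y', hy', δ', hδ', e⟩
    obtain ⟨c, hc⟩ := exists_vadd_eq_of_wobbleCode_eq hδ hδ' e.symm
    apply hne
    rw [← AddAction.orbit_eq_iff.2 hy, ← AddAction.orbit_eq_iff.2 hy', ← hc]
    exact AddAction.orbit_eq_iff.2 ⟨c, rfl⟩
  · ext z
    simp only [mem_iUnion]
    constructor
    · rintro ⟨x, hx, δ, hδ, rfl⟩
      exact ⟨x, hx, x, AddAction.mem_orbit_self x, δ, hδ, rfl⟩
    · rintro ⟨x, hx, _, ⟨t, rfl⟩, δ, hδ, rfl⟩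
      exact ⟨_, X.vadd_mem' t x hx, δ, hδ, rfl⟩
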